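/- Consider a single-hop radio network of $n\ge 1$ nodes with unique ids from $[n]=\{1,\dots,n\}$ and with $C\ge 1$ channels, without collision detection. Time proceeds in synchronous rounds. At the beginning an adversary activates an arbitrary nonempty set $T\subseteq[n]$ of nodes. In each round every active node chooses one channel and either transmits a message on it or receives on it, where the choice depends on its id, its random seed and what it has received in earlier rounds (an arbitrary randomized algorithm, which may depend on $n$ and $C$, with messages from a countable set; the seeds of the nodes may have any joint distribution, for example be independent; active nodes have no advance knowledge of $T$). Inactive nodes only listen, on channel $1$. A node that receives on channel $c$ gets a message if and only if exactly one node transmits on $c$ in this round, and otherwise it gets nothing; in particular it cannot distinguish silence from collision. A transmitting node gets nothing. Wake-up is solved in the first round in which an active node is the only transmitter on channel $1$. An algorithm solves wake-up with high probability in $t$ rounds if, for every nonempty $T\subseteq[n]$, wake-up is solved within the first $t$ rounds with probability at least $1-\frac1n$. Theorem. There is an absolute constant $c>0$ such that for all $n\ge 1$ and $C\ge 1$, every algorithm for $n$ nodes and $C$ channels that solves wake-up with high probability in $t$ rounds satisfies $$t \;\ge\; c\left(\frac{\log^2 n}{C}+\log n\right).$$ In particular, if an algorithm solves wake-up with high probability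 in $f(n,C)$ rounds, then $f(n,C)\in\Omega\!\left(\frac{\log^2 n}{C}+\log n\right)$, with a constant that does not depend on $C$. -/

import Mathlib

universe u v

/-- What a node does in one round: it picks one of the `C` channels and on that channel it either
transmits a message or receives. -/
inductive RadioAction (C : ℕ) (Msg : Type v) : Type v
  | transmit (ch : Fin C) (m : Msg) : RadioAction C Msg
  | receive (ch : Fin C) : RadioAction C Msg

/-- A randomized algorithm for a single-hop network of `n` nodes with unique ids `Fin n` and `C`
channels. An active node `i` is given its id `i`, its private random seed and the list of what it
has received in the previous rounds (most recent first; `none` stands for receiving nothing), and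
from these it computes its next action, so it has no advance knowledge of which nodes are active.
The seeds have an arbitrary joint law, in particular they may be independent (a product measure). -/
structure WakeUpAlgorithm (n C : ℕ) where
  Seed : Type u
  Msg : Type v
  [measurableSpaceSeed : MeasurableSpace Seed]
  [countableMsg : Countable Msg]
  law : MeasureTheory.Measure (Fin n → Seed)
  [isProbabilityMeasureLaw : MeasureTheory.IsProbabilityMeasure law]
  act : Fin n → Seed → List (Option Msg) → RadioAction C Msg
  measurableSet_act : ∀ (i : Fin n) (h : List (Option Msg)) (a : RadioAction C Msg),
    MeasurableSet {s : Seed | act i s h = a}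

attribute [instance] WakeUpAlgorithm.measurableSpaceSeed
attribute [instance] WakeUpAlgorithm.countableMsg
attribute [instance] WakeUpAlgorithm.isProbabilityMeasureLaw

open scoped Classical in
/-- The nodes that transmit on channel `ch` when `T` is the set of active nodes and `a` is the
action profile (inactive nodes never transmit). -/
noncomputable def transmitters {n C : ℕ} {Msg : Type v} (T : Finset (Fin n))
    (a : Fin n → RadioAction C Msg) (ch : Fin C) : Finset (Fin n) :=
  T.filter (fun i => ∃ m : Msg, a i = RadioAction.transmit ch m)

/-- Node `i` receives message `m`: it receives on some channel, exactly one node transmits on this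
channel, and that node transmits `m` (all nodes are neighbours). -/
def Receives {n C : ℕ} {Msg : Type v} (T : Finset (Fin n)) (a : Fin n → RadioAction C Msg)
    (i : Fin n) (m : Msg) : Prop :=
  ∃ (ch : Fin C) (j : Fin n), a i = RadioAction.receive ch ∧ transmitters T a ch = {j} ∧
    a j = RadioAction.transmit ch m

open scoped Classical in
/-- What node `i` observes at the end of a round: the message it receives, or `none`. Without
collision detection, silence and collision are the same observation; a transmitter observes
`none`. -/
noncomputable def observation {n C : ℕ} {Msg : Type v} (T : Finset (Fin n))
    (a : Fin n → RadioAction C Msg) (i : Fin n) : Option Msg :=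
  if h : ∃ m : Msg, Receives T a i m then some h.choose else none

theorem Receives.unique {n C : ℕ} {Msg : Type v} {T : Finset (Fin n)}
    {a : Fin n → RadioAction C Msg} {i : Fin n} {m m' : Msg}
    (h : Receives T a i m) (h' : Receives T a i m') : m = m' := by
  obtain ⟨ch, j, h1, h2, h3⟩ := h
  obtain ⟨ch', j', h1', h2', h3'⟩ := h'
  have hc : ch = ch' := by
    have := h1.symm.trans h1'
    injection this
  subst hc
  have hj : j = j' := Finset.singleton_injective (h2.symm.trans h2')
  subst hj
  have := h3.symm.trans h3'
  injection this

theorem observation_eq_some_iff {n C : ℕ} {Msg : Type v} {T : Finset (Fin n)}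
    {a : Fin n → RadioAction C Msg} {i : Fin n} {m : Msg} :
    observation T a i = some m ↔ Receives T a i m := by
  unfold observation
  constructor
  · intro h
    split_ifs at h with hm
    have := hm.choose_spec
    rwa [Option.some.inj h] at this
  · intro h
    have hm : ∃ m : Msg, Receives T a i m := ⟨m, h⟩
    rw [dif_pos hm, hm.choose_spec.unique h]

namespace WakeUpAlgorithm

variable {n C : ℕ} (A : WakeUpAlgorithm.{u, v} n C)

/-- What node `i` has observed in the first `r` rounds (most recent first) of the execution in
which the nodes in `T` are activated at the beginning and the seeds are `ω`. Only the entries of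
nodes in `T` matter. Inactive nodes just listen, on the default channel, so the execution is
described up to the round in which they wake up, which is the round that solves the problem. -/
noncomputable def history (T : Finset (Fin n)) (ω : Fin n → A.Seed) :
    ℕ → Fin n → List (Option A.Msg)
  | 0 => fun _ => []
  | r + 1 => fun i =>
      observation T (fun j => A.act j (ω j) (history T ω r j)) i :: history T ω r i

/-- The actions of the nodes in round `r` (rounds are numbered from `0`). -/
noncomputable def actions (T : Finset (Fin n)) (ω : Fin n → A.Seed) (r : ℕ) :
    Fin n → RadioAction C A.Msg :=
  fun i => A.act i (ω i) (A.history T ω r i)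

/-- Within the first `t` rounds there is a round in which an active node broadcasts alone on the
default channel, which is the channel number `0`. -/
def SolvedWithin (T : Finset (Fin n)) (ω : Fin n → A.Seed) (t : ℕ) : Prop :=
  ∃ r < t, ∃ ch : Fin C, (ch : ℕ) = 0 ∧ ∃ i : Fin n, transmitters T (A.actions T ω r) ch = {i}

/-- `A` solves wake-up with high probability in `t` rounds: whichever nonempty set of nodes the
adversary activates, the problem is solved within `t` rounds with probability at least `1 - 1/n`. -/
def SolvesWakeUpWHP (t : ℕ) : Prop :=
  ∀ T : Finset (Fin n), T.Nonempty →
    1 - 1 / (n : ℝ) ≤ A.law.real {ω : Fin n → A.Seed | A.SolvedWithin T ω t}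

end WakeUpAlgorithm

/-! As long as no active node receives anything, an adaptive algorithm acts like an oblivious one:
the seeds alone fix the pattern of transmissions (`silentPattern`). If every round of that pattern
is quiet for `T`, nobody ever receives a message and wake-up fails
(`not_solvedWithin_of_quietRound`). By averaging (`SolvesWakeUpWHP.le_sum_div`), it is enough to
give weighted activation sets of which a large weight stays quiet under every fixed pattern. No
independence of the seeds is needed.

For `log n`, take pairs of nodes. Two nodes that agree in each round on receiving, transmitting on
the default channel or transmitting elsewhere stay quiet, and there are only `3 ^ t` such behaviours
(`SolvesWakeUpWHP.le_two_mul_three_pow`).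

For `log² n / C`, take random sets of density `2 ^ (-(k + 1))` with `k < K`, where `K` is of order
`log n`. A pattern amounts to `t * C` sets of transmitters, one for each round and channel. At any
scale, the small sets are avoided altogether and the large ones are hit at least twice; these
increasing events are combined by Harris' inequality (`exp_le_bernoulliProb`). Each transmitter set
is expensive at few scales, so the total cost over all scales is `O(t * C)`, and some scale stays
quiet with probability at least `exp (-34 * t * C / K)` (`exists_scale_exp_le`). Comparing this with
the failure probability `1 / n` gives `K ^ 2 = O(t * C)`. -/

/-- The probability that the random subset of `α` that contains each `i` independently with
probability `x i` equals `T`. -/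
def bernoulliWeight {α : Type*} [Fintype α] [DecidableEq α] (x : α → ℝ) (T : Finset α) : ℝ :=
  ∏ i, if i ∈ T then x i else 1 - x i

/-! ### Random subsets and the probability of isolating no element -/

section BernoulliWeight

variable {α ι : Type*} [Fintype α] [DecidableEq α] {x : α → ℝ}

theorem bernoulliWeight_nonneg (h0 : ∀ i, 0 ≤ x i) (h1 : ∀ i, x i ≤ 1) (T : Finset α) :
    0 ≤ bernoulliWeight x T := by
  refine Finset.prod_nonneg fun i _ => ?_
  split_ifs
  · exact h0 i
  · linarith [h1 i]

theorem sum_bernoulliWeight_mul_prod (x c : α → ℝ) :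
    ∑ T : Finset α, bernoulliWeight x T * ∏ i ∈ T, c i = ∏ i, (x i * c i + (1 - x i)) := by
  rw [Fintype.prod_add]
  refine Finset.sum_congr rfl fun T _ => ?_
  rw [Finset.prod_mul_distrib, bernoulliWeight, ← Finset.prod_mul_prod_compl T,
    Finset.prod_congr rfl (fun i hi => if_pos hi),
    Finset.prod_congr rfl (fun i hi => if_neg (Finset.mem_compl.mp hi))]
  ring

theorem sum_bernoulliWeight (x : α → ℝ) : ∑ T : Finset α, bernoulliWeight x T = 1 := by
  simpa using sum_bernoulliWeight_mul_prod x 1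

theorem bernoulliWeight_empty (x : α → ℝ) : bernoulliWeight x ∅ = ∏ i, (1 - x i) := by
  simp [bernoulliWeight]

/-- At each coordinate both sides have the same two factors, possibly swapped. This is the lattice
condition of `fkg`, with equality. -/
theorem bernoulliWeight_mul_inf_sup (x : α → ℝ) (S T : Finset α) :
    bernoulliWeight x S * bernoulliWeight x T =
      bernoulliWeight x (S ⊓ T) * bernoulliWeight x (S ⊔ T) := by
  simp only [bernoulliWeight, ← Finset.prod_mul_distrib]
  refine Finset.prod_congr rfl fun i _ => ?_
  by_cases hS : i ∈ S <;> by_cases hT : i ∈ T <;> simp [hS, hT, mul_comm]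

/-- The probability that the random subset of `α` that contains each `i` independently with
probability `x i` lies in `E`. -/
noncomputable def bernoulliProb (x : α → ℝ) (E : Set (Finset α)) : ℝ :=
  ∑ T, bernoulliWeight x T * E.indicator 1 T

theorem bernoulliProb_nonneg (h0 : ∀ i, 0 ≤ x i) (h1 : ∀ i, x i ≤ 1) (E : Set (Finset α)) :
    0 ≤ bernoulliProb x E :=
  Finset.sum_nonneg fun T _ => mul_nonneg (bernoulliWeight_nonneg h0 h1 T)
    (Set.indicator_nonneg (fun _ _ => zero_le_one) T)

/-- Harris' inequality: increasing events are positively correlated. -/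
theorem prod_bernoulliProb_le (h0 : ∀ i, 0 ≤ x i) (h1 : ∀ i, x i ≤ 1) (J : Finset ι)
    (E : ι → Set (Finset α)) (hE : ∀ j, IsUpperSet (E j)) :
    ∏ j ∈ J, bernoulliProb x (E j) ≤ bernoulliProb x (⋂ j ∈ J, E j) := by
  classical
  have hmono : ∀ P : Set (Finset α), IsUpperSet P → Monotone (P.indicator (1 : Finset α → ℝ)) := by
    intro P hP S T hST
    by_cases hS : S ∈ P
    · simp [hS, hP hST hS]
    · rw [Set.indicator_of_notMem hS]
      exact Set.indicator_nonneg (fun _ _ => zero_le_one) T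
  have hnonneg : ∀ P : Set (Finset α), 0 ≤ P.indicator (1 : Finset α → ℝ) :=
    fun P T => Set.indicator_nonneg (fun _ _ => zero_le_one) T
  induction J using Finset.induction_on with
  | empty => simp [bernoulliProb, sum_bernoulliWeight]
  | insert j J hj ih =>
    rw [Finset.prod_insert hj]
    have hall : IsUpperSet (⋂ j ∈ J, E j) := isUpperSet_iInter₂ fun i _ => hE i
    have key := fkg _ _ _ (bernoulliWeight_nonneg h0 h1)
      (hnonneg _) (hnonneg _) (hmono _ (hE j)) (hmono _ hall)
      (fun S T => (bernoulliWeight_mul_inf_sup x S T).le)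
    rw [sum_bernoulliWeight, one_mul] at key
    refine (mul_le_mul_of_nonneg_left ih (bernoulliProb_nonneg h0 h1 _)).trans
      (key.trans (le_of_eq ?_))
    refine Finset.sum_congr rfl fun T _ => ?_
    rw [Finset.set_biInter_insert, Set.inter_indicator_one, Pi.mul_apply]

/-- A set of expected size `μ` has at least two elements with probability at least
`1 - 2 * exp (-μ / 2)`. -/
theorem one_sub_le_bernoulliProb (h0 : ∀ i, 0 ≤ x i) (h1 : ∀ i, x i ≤ 1) (S : Finset α) :
    1 - 2 * Real.exp (-(∑ i ∈ S, x i) / 2) ≤ bernoulliProb x {T | 2 ≤ (S ∩ T).card} := by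
  -- Generating function of `|S ∩ T|` at `1 / 2`; the value `1 - 2 * (1 / 2) ^ m` is at most `0` for
  -- `m ≤ 1` and at most `1` always.
  have hgen := sum_bernoulliWeight_mul_prod x (fun i => if i ∈ S then (1 / 2 : ℝ) else 1)
  have hprod : ∏ i, (x i * (if i ∈ S then (1 / 2 : ℝ) else 1) + (1 - x i)) ≤
      Real.exp (-(∑ i ∈ S, x i) / 2) := by
    have : -(∑ i ∈ S, x i) / 2 = ∑ i, if i ∈ S then -(x i / 2) else 0 := by
      rw [Finset.sum_ite_mem, Finset.univ_inter, Finset.sum_neg_distrib, ← Finset.sum_div]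
      ring
    rw [this, Real.exp_sum]
    refine Finset.prod_le_prod (fun i _ => ?_) (fun i _ => ?_)
    · have := h0 i
      have := h1 i
      split_ifs <;> linarith
    · split_ifs
      · have := Real.one_sub_le_exp_neg (x i / 2)
        linarith
      · simp
  have hpt : ∀ T : Finset α, (1 : ℝ) - 2 * ∏ i ∈ T, (if i ∈ S then (1 / 2 : ℝ) else 1) ≤
      {T : Finset α | 2 ≤ (S ∩ T).card}.indicator 1 T := by
    intro T
    have hT : ∏ i ∈ T, (if i ∈ S then (1 / 2 : ℝ) else 1) = (1 / 2) ^ (S ∩ T).card := by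
      rw [Finset.prod_ite_mem, Finset.prod_const, Finset.inter_comm]
    rw [hT]
    by_cases h : 2 ≤ (S ∩ T).card
    · rw [Set.indicator_of_mem (s := {T : Finset α | 2 ≤ (S ∩ T).card}) h, Pi.one_apply]
      have : (0 : ℝ) ≤ (1 / 2) ^ (S ∩ T).card := by positivity
      linarith
    · rw [Set.indicator_of_notMem (s := {T : Finset α | 2 ≤ (S ∩ T).card}) h]
      have : (1 / 2 : ℝ) ^ 1 ≤ (1 / 2) ^ (S ∩ T).card :=
        pow_le_pow_of_le_one (by norm_num) (by norm_num) (by omega)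
      linarith
  calc 1 - 2 * Real.exp (-(∑ i ∈ S, x i) / 2)
      ≤ ∑ T, bernoulliWeight x T - 2 * ∑ T, bernoulliWeight x T *
          ∏ i ∈ T, (if i ∈ S then (1 / 2 : ℝ) else 1) := by
        rw [hgen, sum_bernoulliWeight]; linarith
    _ = ∑ T, bernoulliWeight x T * (1 - 2 * ∏ i ∈ T, (if i ∈ S then (1 / 2 : ℝ) else 1)) := by
        rw [Finset.mul_sum, ← Finset.sum_sub_distrib]
        exact Finset.sum_congr rfl fun T _ => by ring
    _ ≤ _ := Finset.sum_le_sum fun T _ =>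
        mul_le_mul_of_nonneg_left (hpt T) (bernoulliWeight_nonneg h0 h1 T)

theorem exp_neg_two_mul_le_one_sub {y : ℝ} (h0 : 0 ≤ y) (h1 : y ≤ 1 / 2) :
    Real.exp (-(2 * y)) ≤ 1 - y := by
  have hpos : 0 < 1 - y := by linarith
  rw [← Real.le_log_iff_exp_le hpos]
  refine le_trans ?_ (Real.one_sub_inv_le_log_of_pos hpos)
  have : (1 - y)⁻¹ ≤ 1 + 2 * y := by
    rw [inv_le_iff_one_le_mul₀ hpos]
    nlinarith
  linarith

/-- Deleting `U` from a random set of density `p` costs a factor `(1 - p) ^ |U|`. -/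
theorem pow_mul_bernoulliWeight_le {p : ℝ} (h0 : 0 ≤ p) (h1 : p ≤ 1) (U T : Finset α) :
    (1 - p) ^ U.card * bernoulliWeight (fun i => if i ∈ U then 0 else p) T ≤
      bernoulliWeight (fun _ => p) T := by
  have : (1 - p) ^ U.card = ∏ i, if i ∈ U then 1 - p else 1 := by
    rw [Finset.prod_ite_mem, Finset.univ_inter, Finset.prod_const]
  rw [this, bernoulliWeight, bernoulliWeight, ← Finset.prod_mul_distrib]
  refine Finset.prod_le_prod (fun i _ => ?_) (fun i _ => ?_) <;>
    split_ifs <;> simp <;> linarith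

theorem bernoulliWeight_eq_zero_of_mem {p : ℝ} {U T : Finset α} {i : α} (hU : i ∈ U) (hT : i ∈ T) :
    bernoulliWeight (fun i => if i ∈ U then 0 else p) T = 0 :=
  Finset.prod_eq_zero (Finset.mem_univ i) (by simp [hU, hT])

/-- If the sets `S j` with `j ∈ J` lie in `U` and the others have many elements outside `U`, then a
random set of density `p` isolates no element of any `S j` with a good probability. -/
theorem exp_le_bernoulliProb [Fintype ι] [DecidableEq ι] {p : ℝ} (h0 : 0 < p) (h1 : p ≤ 1 / 2)
    (S : ι → Finset α) (U : Finset α) (J : Finset ι) (hJ : ∀ j ∈ J, S j ⊆ U)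
    (hJc : ∀ j, j ∉ J → 8 ≤ p * (S j \ U).card) :
    Real.exp (-(2 * (p * U.card) + ∑ j ∈ Jᶜ, 8 / (p * (S j \ U).card))) ≤
      bernoulliProb (fun _ => p) {T | ∀ j, (S j ∩ T).card ≠ 1} := by
  -- Conditioning on avoiding `U`: under `x` the sets indexed by `J` are never hit, and the other
  -- sets only need the increasing event of being hit twice.
  set x : α → ℝ := fun i => if i ∈ U then 0 else p with hx
  have hx0 : ∀ i, 0 ≤ x i := fun i => by simp only [hx]; split_ifs <;> linarith
  have hx1 : ∀ i, x i ≤ 1 := fun i => by simp only [hx]; split_ifs <;> linarith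
  have hharris := prod_bernoulliProb_le hx0 hx1 Jᶜ (fun j => {T | 2 ≤ (S j ∩ T).card})
    (fun j A B hAB h => le_trans h (Finset.card_le_card (Finset.inter_subset_inter_left hAB)))
  have hsum : ∀ j, ∑ i ∈ S j, x i = p * (S j \ U).card := by
    intro j
    rw [← Finset.sum_sdiff (Finset.inter_subset_left (s₁ := S j) (s₂ := U)),
      Finset.sdiff_inter_self_left,
      Finset.sum_congr rfl (fun i hi => if_neg (Finset.mem_sdiff.mp hi).2),
      Finset.sum_congr rfl (fun i hi => if_pos (Finset.mem_inter.mp hi).2)]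
    simp [mul_comm]
  have hfac : ∀ j ∈ Jᶜ, Real.exp (-(8 / (p * (S j \ U).card))) ≤
      bernoulliProb x {T | 2 ≤ (S j ∩ T).card} := by
    intro j hj
    refine le_trans ?_ (one_sub_le_bernoulliProb hx0 hx1 (S j))
    rw [hsum]
    have hl := hJc j (Finset.mem_compl.mp hj)
    set l : ℝ := p * (S j \ U).card
    have hf : 2 * Real.exp (-l / 2) ≤ 4 / l := by
      have : l / 2 ≤ Real.exp (l / 2) := by linarith [Real.add_one_le_exp (l / 2)]
      rw [neg_div, Real.exp_neg]
      calc 2 * (Real.exp (l / 2))⁻¹ ≤ 2 * (l / 2)⁻¹ := by gcongr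
        _ = 4 / l := by field_simp; norm_num
    have h4 : 4 / l ≤ 1 / 2 := by
      rw [div_le_iff₀ (by linarith)]; linarith
    have := exp_neg_two_mul_le_one_sub (y := 4 / l) (by positivity) h4
    rw [show 8 / l = 2 * (4 / l) by ring]
    linarith
  have hU : Real.exp (-(2 * (p * U.card))) ≤ (1 - p) ^ U.card := by
    have := pow_le_pow_left₀ (Real.exp_pos _).le
      (exp_neg_two_mul_le_one_sub h0.le h1) U.card
    rwa [← Real.exp_nat_mul, show (U.card : ℝ) * -(2 * p) = -(2 * (p * U.card)) by ring] at this
  have hprod : Real.exp (-∑ j ∈ Jᶜ, 8 / (p * (S j \ U).card)) ≤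
      bernoulliProb x (⋂ j ∈ Jᶜ, {T | 2 ≤ (S j ∩ T).card}) := by
    refine le_trans ?_ hharris
    rw [← Finset.sum_neg_distrib, Real.exp_sum]
    exact Finset.prod_le_prod (fun _ _ => (Real.exp_pos _).le) hfac
  rw [neg_add, Real.exp_add]
  refine (mul_le_mul hU hprod (Real.exp_pos _).le (pow_nonneg (by linarith) _)).trans ?_
  rw [bernoulliProb, bernoulliProb, Finset.mul_sum]
  refine Finset.sum_le_sum fun T _ => ?_
  rw [← mul_assoc]
  have hw := bernoulliWeight_nonneg (x := fun _ : α => p) (fun _ => h0.le)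
    (fun _ => by linarith) T
  have hind : ∀ E : Set (Finset α), 0 ≤ E.indicator (1 : Finset α → ℝ) T :=
    fun E => Set.indicator_nonneg (fun _ _ => zero_le_one) T
  by_cases hT : Disjoint U T
  · refine mul_le_mul (pow_mul_bernoulliWeight_le h0.le (by linarith) U T) ?_ (hind _) hw
    by_cases hall : T ∈ ⋂ j ∈ Jᶜ, {T | 2 ≤ (S j ∩ T).card}
    · have : T ∈ {T | ∀ j, (S j ∩ T).card ≠ 1} := by
        intro j
        by_cases hj : j ∈ J
        · rw [Finset.disjoint_iff_inter_eq_empty.mp (hT.mono_left (hJ j hj))]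
          simp
        · have : 2 ≤ (S j ∩ T).card := Set.mem_iInter₂.mp hall j (Finset.mem_compl.mpr hj)
          omega
      rw [Set.indicator_of_mem hall, Set.indicator_of_mem this]
    · rw [Set.indicator_of_notMem hall]
      exact hind _
  · obtain ⟨i, hi, hi'⟩ := Finset.not_disjoint_iff.mp hT
    rw [hx, bernoulliWeight_eq_zero_of_mem hi hi', mul_zero, zero_mul]
    exact mul_nonneg hw (hind _)

end BernoulliWeight

/-! ### Choosing the avoided sets at each scale and averaging the cost -/

section Scales

variable {α ι : Type*} [DecidableEq α] [Fintype ι] [DecidableEq ι]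

/-- Take `J` maximal subject to paying at most `h` new points per added index. A set outside `J`
with fewer than `h` points beyond the union could still be afforded. -/
theorem exists_absorbing_superset (S : ι → Finset α) (h : ℕ) (J₀ : Finset ι) :
    ∃ J, J₀ ⊆ J ∧ (J.biUnion S).card ≤ (J₀.biUnion S).card + h * (J \ J₀).card ∧
      ∀ j, j ∉ J → h ≤ (S j \ J.biUnion S).card := by
  have hfin : {J : Finset ι | J₀ ⊆ J ∧
      (J.biUnion S).card ≤ (J₀.biUnion S).card + h * (J \ J₀).card}.Finite := Set.toFinite _
  obtain ⟨J, ⟨hJ₀, hJ⟩, hmax⟩ := hfin.exists_maximal ⟨J₀, subset_rfl, by simp⟩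
  refine ⟨J, hJ₀, hJ, fun j hj => ?_⟩
  by_contra! hlt
  refine hj (hmax ⟨hJ₀.trans (Finset.subset_insert j J), ?_⟩ (Finset.subset_insert j J)
    (Finset.mem_insert_self j J))
  have hcard : (insert j J \ J₀).card = (J \ J₀).card + 1 := by
    rw [Finset.insert_sdiff_of_notMem _ (fun hj₀ => hj (hJ₀ hj₀)), Finset.card_insert_of_notMem]
    exact fun h' => hj (Finset.mem_sdiff.mp h').1
  have hunion : ((insert j J).biUnion S).card =
      (S j \ J.biUnion S).card + (J.biUnion S).card := by
    rw [Finset.biUnion_insert, ← Finset.sdiff_union_self_eq_union,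
      Finset.card_union_of_disjoint Finset.sdiff_disjoint]
  rw [hcard, hunion, mul_add, mul_one]
  omega

/-- The exponent in the bound for the probability that a random set of density
`(1 / 2) ^ (k + 1)` isolates no element of the sets `S j`, when those with `j ∈ J` are avoided. -/
noncomputable def scaleCost (S : ι → Finset α) (k : ℕ) (J : Finset ι) : ℝ :=
  2 * ((1 / 2 : ℝ) ^ (k + 1) * (J.biUnion S).card) +
    ∑ j ∈ Jᶜ, 8 / ((1 / 2 : ℝ) ^ (k + 1) * (S j \ J.biUnion S).card)

/-- Absorption is iterated with a threshold that doubles with the scale: at density `2 ^ (-(k +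
1))`, the `16 * 2 ^ k` remaining points give expected size at least `8`. -/
theorem exists_absorbing_chain (S : ι → Finset α) :
    ∃ J : ℕ → Finset ι, (∀ k, J k ⊆ J (k + 1)) ∧
      ((J 0).biUnion S).card ≤ 16 * (J 0).card ∧
      (∀ k, ((J (k + 1)).biUnion S).card ≤
        ((J k).biUnion S).card + 16 * 2 ^ (k + 1) * (J (k + 1) \ J k).card) ∧
      ∀ k, ∀ j ∉ J k, 16 * 2 ^ k ≤ (S j \ (J k).biUnion S).card := by
  choose F hsub hcard habs using exists_absorbing_superset S
  let J : ℕ → Finset ι := fun k =>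
    Nat.rec (F 16 ∅) (fun k J => F (16 * 2 ^ (k + 1)) J) k
  refine ⟨J, fun k => hsub _ _, ?_, fun k => hcard _ _, fun k j hj => ?_⟩
  · have h : (J 0 \ ∅).card = (J 0).card := by rw [Finset.sdiff_empty]
    refine (hcard 16 ∅).trans ?_
    rw [Finset.biUnion_empty, Finset.card_empty, zero_add]
    exact (congrArg (16 * ·) h).le
  cases k with
  | zero => exact habs 16 ∅ j hj
  | succ k => exact habs _ _ j hj

/-- On average over the scales `k < K`, the cost is at most `34 * |ι| / K`. -/
theorem exists_chain_sum_scaleCost_le (S : ι → Finset α) :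
    ∃ J : ℕ → Finset ι, (∀ k, ∀ j ∉ J k, 8 ≤ (1 / 2 : ℝ) ^ (k + 1) * (S j \ (J k).biUnion S).card) ∧
      ∀ K, ∑ k ∈ Finset.range K, scaleCost S k (J k) ≤ 34 * Fintype.card ι := by
  obtain ⟨J, hmono, hzero, hsucc, habs⟩ := exists_absorbing_chain S
  set B : ℕ → ℝ := fun k => (1 / 2) ^ (k + 1) * ((J k).biUnion S).card with hB
  set l : ℕ → ι → ℝ := fun k j => (1 / 2) ^ (k + 1) * (S j \ (J k).biUnion S).card with hl
  have hl8 : ∀ k, ∀ j ∉ J k, 8 ≤ l k j := by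
    intro k j hj
    have h : ((16 * 2 ^ k : ℕ) : ℝ) ≤ (S j \ (J k).biUnion S).card := by
      exact_mod_cast habs k j hj
    calc (8 : ℝ) = (1 / 2) ^ (k + 1) * ((16 * 2 ^ k : ℕ) : ℝ) := by
          push_cast
          rw [one_div, inv_pow, pow_succ]
          field_simp
          norm_num
      _ ≤ l k j := mul_le_mul_of_nonneg_left h (by positivity)
  refine ⟨J, hl8, fun K => ?_⟩
  have hBnonneg : ∀ k, 0 ≤ B k := fun k => by positivity
  have hBsucc : ∀ k, B (k + 1) ≤ B k / 2 + 8 * (J (k + 1) \ J k).card := by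
    intro k
    have h : (((J (k + 1)).biUnion S).card : ℝ) ≤
        ((J k).biUnion S).card + 16 * 2 ^ (k + 1) * (J (k + 1) \ J k).card := by
      exact_mod_cast hsucc k
    calc B (k + 1) ≤ (1 / 2) ^ (k + 1 + 1) *
          (((J k).biUnion S).card + 16 * 2 ^ (k + 1) * (J (k + 1) \ J k).card) :=
          mul_le_mul_of_nonneg_left h (by positivity)
      _ = _ := by
          simp only [hB, one_div, inv_pow, pow_succ]
          field_simp
          ring
  -- The extra term `B K` makes the induction close: one step adds `2 * B (K + 1) - B K`, at most
  -- `16` per newly absorbed index.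
  have hsumB : ∀ K, ∑ k ∈ Finset.range (K + 1), B k + B K ≤ 16 * (J K).card := by
    intro K
    induction K with
    | zero =>
      have h : (((J 0).biUnion S).card : ℝ) ≤ 16 * (J 0).card := by exact_mod_cast hzero
      simp only [zero_add, Finset.sum_range_one, hB]
      linarith
    | succ K ih =>
      rw [Finset.sum_range_succ]
      have h1 := hBsucc K
      have h2 : ((J (K + 1) \ J K).card : ℝ) + (J K).card = (J (K + 1)).card := by
        exact_mod_cast Finset.card_sdiff_add_card_eq_card (hmono K)
      linarith
  have hlsucc : ∀ k j, j ∉ J (k + 1) → 2 * (1 / l k j) ≤ 1 / l (k + 1) j := by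
    intro k j hj
    have hpos : 0 < l (k + 1) j := by linarith [hl8 _ _ hj]
    have hle : 2 * l (k + 1) j ≤ l k j := by
      have : ((S j \ (J (k + 1)).biUnion S).card : ℝ) ≤ (S j \ (J k).biUnion S).card := by
        exact_mod_cast Finset.card_le_card
          (Finset.sdiff_subset_sdiff subset_rfl (Finset.biUnion_subset_biUnion_of_subset_left S (hmono k)))
      calc 2 * l (k + 1) j = (1 / 2) ^ (k + 1) * (S j \ (J (k + 1)).biUnion S).card := by
            simp only [hl, pow_succ]; ring
        _ ≤ l k j := mul_le_mul_of_nonneg_left this (by positivity)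
    rw [mul_one_div, div_le_div_iff₀ (by linarith) hpos]
    linarith
  -- While `j` is not absorbed, `1 / l k j` at least doubles with `k`, so the sum is at most twice
  -- its last term, which is at most `1 / 8`. After absorption the sum stays fixed.
  have hsuml : ∀ j K, ∑ k ∈ Finset.range (K + 1), (if j ∉ J k then 1 / l k j else 0) ≤
      if j ∉ J K then 2 * (1 / l K j) else 1 / 4 := by
    intro j K
    induction K with
    | zero =>
      by_cases h : j ∈ J 0
      · simp [h]
      · have := hl8 0 j h
        have : 0 ≤ 1 / l 0 j := by positivity
        simp only [zero_add, Finset.sum_range_one, h, not_false_eq_true, if_true]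
        linarith
    | succ K ih =>
      rw [Finset.sum_range_succ]
      by_cases h' : j ∈ J K
      · have h : j ∈ J (K + 1) := hmono K h'
        simp only [h, h', not_true_eq_false, if_false, add_zero] at ih ⊢
        exact ih
      · simp only [h', not_false_eq_true, if_true] at ih
        by_cases h : j ∈ J (K + 1)
        · simp only [h, not_true_eq_false, if_false, add_zero]
          have h8 := hl8 K j h'
          have : 1 / l K j ≤ 1 / 8 := one_div_le_one_div_of_le (by norm_num) h8
          linarith
        · simp only [h, not_false_eq_true, if_true]
          have := hlsucc K j h
          linarith
  have hsuml' : ∀ j K, ∑ k ∈ Finset.range K, (if j ∉ J k then 1 / l k j else 0) ≤ 1 / 4 := by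
    intro j K
    cases K with
    | zero => norm_num
    | succ K =>
      refine (hsuml j K).trans ?_
      by_cases h : j ∈ J K
      · simp [h]
      · have : 1 / l K j ≤ 1 / 8 := one_div_le_one_div_of_le (by norm_num) (hl8 K j h)
        simp only [h, not_false_eq_true, if_true]
        linarith
  have hsumB' : ∑ k ∈ Finset.range K, B k ≤ 16 * Fintype.card ι := by
    cases K with
    | zero => simp
    | succ K =>
      have h : ((J K).card : ℝ) ≤ Fintype.card ι := by exact_mod_cast Finset.card_le_univ _
      linarith [hsumB K, hBnonneg K]
  have hcost : ∀ k, scaleCost S k (J k) =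
      2 * B k + ∑ j, 8 * (if j ∉ J k then 1 / l k j else 0) := by
    intro k
    simp only [scaleCost, mul_ite, mul_zero, mul_one_div]
    rw [← Finset.sum_filter]
    congr 2
    exact Finset.ext fun j => by simp
  simp only [hcost]
  rw [Finset.sum_add_distrib, ← Finset.mul_sum, Finset.sum_comm]
  -- Each index costs at most `8 / 4 = 2` for hitting; avoiding costs `2 * 16` per index, whence
  -- `34`.
  have : ∑ j, ∑ k ∈ Finset.range K, 8 * (if j ∉ J k then 1 / l k j else 0) ≤ ∑ _j : ι, (2 : ℝ) := by
    refine Finset.sum_le_sum fun j _ => ?_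
    rw [← Finset.mul_sum]
    linarith [hsuml' j K]
  rw [Finset.sum_const, Finset.card_univ, nsmul_eq_mul] at this
  linarith

/-- For any sets `S j` there is a scale at which a random set isolates no element of any `S j` with
a good probability. -/
theorem exists_scale_exp_le [Fintype α] (S : ι → Finset α) {K : ℕ} (hK : 0 < K) :
    ∃ k < K, Real.exp (-(34 * Fintype.card ι / K)) ≤
      bernoulliProb (fun _ : α => (1 / 2) ^ (k + 1)) {T | ∀ j, (S j ∩ T).card ≠ 1} := by
  obtain ⟨J, habs, hsum⟩ := exists_chain_sum_scaleCost_le S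
  have hK' : (0 : ℝ) < K := by exact_mod_cast hK
  obtain ⟨k, hk, hle⟩ := Finset.exists_le_of_sum_le (s := Finset.range K)
    (f := fun k => scaleCost S k (J k)) (g := fun _ => 34 * (Fintype.card ι : ℝ) / K)
    ⟨0, Finset.mem_range.mpr hK⟩ (by
      rw [Finset.sum_const, Finset.card_range, nsmul_eq_mul, mul_div_cancel₀ _ hK'.ne']
      exact hsum K)
  refine ⟨k, Finset.mem_range.mp hk, ?_⟩
  refine (Real.exp_le_exp.mpr (neg_le_neg hle)).trans ?_
  rw [scaleCost]
  refine exp_le_bernoulliProb (by positivity) ?_ S _ (J k)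
    (fun j hj => Finset.subset_biUnion_of_mem S hj) (habs k)
  rw [pow_succ]
  have : (1 / 2 : ℝ) ^ k ≤ 1 := pow_le_one₀ (by norm_num) (by norm_num)
  linarith

end Scales

/-! ### Quiet rounds and reduction to oblivious patterns -/

/-- The channel on which an action transmits, if any. -/
def RadioAction.transmitChannel {C : ℕ} {Msg : Type v} : RadioAction C Msg → Option (Fin C)
  | .transmit ch _ => some ch
  | .receive _ => none

theorem RadioAction.transmitChannel_eq_some_iff {C : ℕ} {Msg : Type v} {a : RadioAction C Msg}
    {ch : Fin C} : a.transmitChannel = some ch ↔ ∃ m, a = .transmit ch m := by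
  cases a <;> simp [transmitChannel]

theorem RadioAction.transmitChannel_eq_none_iff {C : ℕ} {Msg : Type v} {a : RadioAction C Msg} :
    a.transmitChannel = none ↔ ∃ ch, a = .receive ch := by
  cases a <;> simp [transmitChannel]

/-- The nodes in `T` that transmit on `ch` when the transmission channels are given by `b`. -/
def soundSet {n C : ℕ} (T : Finset (Fin n)) (b : Fin n → Option (Fin C)) (ch : Fin C) :
    Finset (Fin n) :=
  T.filter (fun i => b i = some ch)

/-- In a round with transmission channels `b` no node of `T` transmits alone on the default channel
and none receives a message. -/
def QuietRound {n C : ℕ} (T : Finset (Fin n)) (b : Fin n → Option (Fin C)) : Prop :=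
  (∀ ch : Fin C, (ch : ℕ) = 0 → (soundSet T b ch).card ≠ 1) ∧
    ∀ ch : Fin C, (soundSet T b ch).card = 1 → ∀ i ∈ T, b i ≠ none

theorem quietRound_of_card_ne_one {n C : ℕ} {T : Finset (Fin n)} {b : Fin n → Option (Fin C)}
    (h : ∀ ch, (soundSet T b ch).card ≠ 1) : QuietRound T b :=
  ⟨fun ch _ => h ch, fun ch hch => absurd hch (h ch)⟩

/-- If both nodes transmit, nobody active listens, so distinct non-default channels do no harm.
Hence only three behaviours matter, whatever `C` is. -/
theorem quietRound_pair {n C : ℕ} {i j : Fin n} (hij : i ≠ j) {b : Fin n → Option (Fin C)}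
    (h : (b i).map (fun ch => decide ((ch : ℕ) = 0)) = (b j).map (fun ch => decide ((ch : ℕ) = 0))) :
    QuietRound {i, j} b := by
  have hcase : (b i = none ∧ b j = none) ∨ ∃ ci cj, b i = some ci ∧ b j = some cj ∧
      ((ci : ℕ) = 0 ↔ (cj : ℕ) = 0) := by
    cases hi : b i <;> cases hj : b j <;> simp_all
  rcases hcase with ⟨hi, hj⟩ | ⟨ci, cj, hi, hj, hc⟩
  · refine quietRound_of_card_ne_one fun ch => ?_
    simp [soundSet, Finset.filter_insert, Finset.filter_singleton, hi, hj]
  · refine ⟨fun ch hch => ?_, fun _ _ k hk => ?_⟩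
    · have hiff : ci = ch ↔ cj = ch := by
        rw [Fin.ext_iff, Fin.ext_iff, hch, hc]
      by_cases h : cj = ch <;>
        simp [soundSet, Finset.filter_insert, Finset.filter_singleton, hi, hj, hiff, h, hij]
    · rcases Finset.mem_insert.mp hk with rfl | hk
      · simp [hi]
      · simp [Finset.mem_singleton.mp hk, hj]

namespace WakeUpAlgorithm

variable {n C : ℕ} (A : WakeUpAlgorithm.{u, v} n C)

/-- The channels on which the nodes transmit in round `r` if they have received nothing so far. -/
def silentPattern (ω : Fin n → A.Seed) (r : ℕ) (i : Fin n) : Option (Fin C) :=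
  (A.act i (ω i) (List.replicate r none)).transmitChannel

variable {A}

theorem transmitters_eq_soundSet {T : Finset (Fin n)} {ω : Fin n → A.Seed} {r : ℕ}
    (h : ∀ i ∈ T, A.history T ω r i = List.replicate r none) (ch : Fin C) :
    transmitters T (A.actions T ω r) ch = soundSet T (A.silentPattern ω r) ch := by
  classical
  unfold transmitters soundSet
  refine Finset.filter_congr fun i hi => ?_
  rw [silentPattern, RadioAction.transmitChannel_eq_some_iff, actions, h i hi]

/-- While all histories are silent, the actual transmitters are those of the silent pattern. A
reception would then need a lone transmitter and an active listener, which the second clause of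
`QuietRound` excludes. -/
theorem history_eq_replicate {T : Finset (Fin n)} {ω : Fin n → A.Seed} {t : ℕ}
    (hq : ∀ r < t, QuietRound T (A.silentPattern ω r)) :
    ∀ r ≤ t, ∀ i ∈ T, A.history T ω r i = List.replicate r none := by
  intro r
  induction r with
  | zero => exact fun _ _ _ => rfl
  | succ r ih =>
    intro hr i hi
    have ih := ih (by omega)
    change observation T (A.actions T ω r) i :: A.history T ω r i = _
    rw [ih i hi, List.replicate_succ]
    congr 1
    by_contra hne
    obtain ⟨m, hm⟩ := Option.ne_none_iff_exists'.mp hne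
    obtain ⟨ch, j, hrec, htr, -⟩ := observation_eq_some_iff.mp hm
    rw [transmitters_eq_soundSet ih] at htr
    refine (hq r (by omega)).2 ch (by rw [htr, Finset.card_singleton]) i hi ?_
    rw [silentPattern, RadioAction.transmitChannel_eq_none_iff, ← ih i hi]
    exact ⟨ch, hrec⟩

theorem not_solvedWithin_of_quietRound {T : Finset (Fin n)} {ω : Fin n → A.Seed} {t : ℕ}
    (hq : ∀ r < t, QuietRound T (A.silentPattern ω r)) : ¬ A.SolvedWithin T ω t := by
  rintro ⟨r, hr, ch, hch, i, hi⟩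
  rw [transmitters_eq_soundSet (history_eq_replicate hq r hr.le)] at hi
  exact (hq r hr).1 ch hch (by rw [hi, Finset.card_singleton])

theorem measurableSet_transmitChannel (i : Fin n) (h : List (Option A.Msg)) (y : Option (Fin C)) :
    MeasurableSet {s : A.Seed | (A.act i s h).transmitChannel = y} := by
  cases y with
  | none =>
    simp only [RadioAction.transmitChannel_eq_none_iff, Set.ofPred_exists]
    exact MeasurableSet.iUnion fun ch => A.measurableSet_act i h _
  | some ch =>
    simp only [RadioAction.transmitChannel_eq_some_iff, Set.ofPred_exists]
    exact MeasurableSet.iUnion fun m => A.measurableSet_act i h _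

theorem measurableSet_forall_quietRound (T : Finset (Fin n)) (t : ℕ) :
    MeasurableSet {ω : Fin n → A.Seed | ∀ r < t, QuietRound T (A.silentPattern ω r)} := by
  have hround : ∀ r, MeasurableSet {ω : Fin n → A.Seed | QuietRound T (A.silentPattern ω r)} := by
    intro r
    have heq : {ω : Fin n → A.Seed | QuietRound T (A.silentPattern ω r)} =
        ⋃ y ∈ {y : Fin n → Option (Fin C) | QuietRound T y}, ⋂ i,
          (fun ω : Fin n → A.Seed => ω i) ⁻¹'
            {s | (A.act i s (List.replicate r none)).transmitChannel = y i} := by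
      ext ω
      simp only [Set.mem_ofPred_eq, Set.mem_iUnion, Set.mem_iInter, Set.mem_preimage, exists_prop]
      refine ⟨fun h => ⟨_, h, fun i => rfl⟩, fun ⟨y, hy, h⟩ => ?_⟩
      rwa [show A.silentPattern ω r = y from funext h]
    rw [heq]
    exact MeasurableSet.biUnion (Set.to_countable _) fun y _ => MeasurableSet.iInter fun i =>
      measurable_pi_apply i (measurableSet_transmitChannel i _ _)
  simp only [Set.ofPred_forall]
  exact MeasurableSet.iInter fun r => MeasurableSet.iInter fun _ => hround r

theorem SolvesWakeUpWHP.law_quiet_le {t : ℕ} (hA : A.SolvesWakeUpWHP t) {T : Finset (Fin n)}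
    (hT : T.Nonempty) :
    A.law.real {ω | ∀ r < t, QuietRound T (A.silentPattern ω r)} ≤ 1 / n := by
  have hsub : {ω | A.SolvedWithin T ω t} ⊆
      {ω | ∀ r < t, QuietRound T (A.silentPattern ω r)}ᶜ :=
    fun ω hω hq => not_solvedWithin_of_quietRound hq hω
  -- Monotonicity asks nothing of the solved event; only the quiet event has to be measurable.
  have h1 := (hA T hT).trans (MeasureTheory.measureReal_mono hsub)
  rw [MeasureTheory.probReal_compl_eq_one_sub (measurableSet_forall_quietRound T t)] at h1
  linarith

/-- Averaging over a weighted family of activation sets: if every pattern of transmissions leaves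
a total weight of at least `δ` quiet, then `δ` is at most `1 / n` times the total weight. -/
theorem SolvesWakeUpWHP.le_sum_div {t : ℕ} (hA : A.SolvesWakeUpWHP t) {κ : Type*} [Fintype κ]
    (T : κ → Finset (Fin n)) (w : κ → ℝ) (hw : ∀ k, 0 ≤ w k) (hT : ∀ k, w k ≠ 0 → (T k).Nonempty)
    {δ : ℝ} (hδ : ∀ b : ℕ → Fin n → Option (Fin C),
      δ ≤ ∑ k, w k * {k | ∀ r < t, QuietRound (T k) (b r)}.indicator 1 k) :
    δ ≤ (∑ k, w k) / n := by
  set F : κ → Set (Fin n → A.Seed) := fun k =>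
    {ω | ∀ r < t, QuietRound (T k) (A.silentPattern ω r)} with hF
  have hmeas : ∀ k, MeasurableSet (F k) := fun k => measurableSet_forall_quietRound (T k) t
  have hint : ∀ k, MeasureTheory.Integrable (fun ω => w k * (F k).indicator (1 : (Fin n → A.Seed) → ℝ) ω) A.law :=
    fun k => ((MeasureTheory.integrable_const (1 : ℝ)).indicator (hmeas k)).const_mul (w k)
  calc δ = ∫ _, δ ∂A.law := by simp
    _ ≤ ∫ ω, ∑ k, w k * (F k).indicator (1 : (Fin n → A.Seed) → ℝ) ω ∂A.law :=
        MeasureTheory.integral_mono (MeasureTheory.integrable_const _)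
          (MeasureTheory.integrable_finsetSum _ fun k _ => hint k)
          (fun ω => hδ (A.silentPattern ω))
    _ = ∑ k, w k * A.law.real (F k) := by
        rw [MeasureTheory.integral_finsetSum _ fun k _ => hint k]
        refine Finset.sum_congr rfl fun k _ => ?_
        rw [MeasureTheory.integral_const_mul, MeasureTheory.integral_indicator_one (hmeas k)]
    _ ≤ ∑ k, w k * (1 / n) := by
        refine Finset.sum_le_sum fun k _ => ?_
        by_cases hk : w k = 0
        · simp [hk]
        · exact mul_le_mul_of_nonneg_left (hA.law_quiet_le (hT k hk)) (hw k)
    _ = (∑ k, w k) / n := by rw [← Finset.sum_mul, mul_one_div]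

end WakeUpAlgorithm

/-! ### The two lower bounds: pairs and random activation sets -/

/-- A labelling of `n` points by `L` labels has at least `n ^ 2 / L` pairs with equal labels. -/
theorem sq_card_le_card_mul_sum_ite {α β : Type*} [Fintype α] [Fintype β] [DecidableEq β]
    (l : α → β) :
    (Fintype.card α : ℝ) ^ 2 ≤
      Fintype.card β * ∑ p : α × α, if l p.1 = l p.2 then (1 : ℝ) else 0 := by
  have h := sq_sum_le_card_mul_sum_sq (s := (Finset.univ : Finset β))
    (f := fun y => ∑ i, if l i = y then (1 : ℝ) else 0)
  have h1 : ∑ y, ∑ i, (if l i = y then (1 : ℝ) else 0) = Fintype.card α := by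
    rw [Finset.sum_comm]; simp
  have h2 : ∑ y, (∑ i, if l i = y then (1 : ℝ) else 0) ^ 2 =
      ∑ p : α × α, if l p.1 = l p.2 then (1 : ℝ) else 0 := by
    simp only [sq, Finset.sum_mul_sum]
    rw [Fintype.sum_prod_type, Finset.sum_comm]
    refine Finset.sum_congr rfl fun i _ => ?_
    rw [Finset.sum_comm]
    refine Finset.sum_congr rfl fun j _ => ?_
    simp [eq_comm]
  rwa [h1, h2, Finset.card_univ] at h

namespace WakeUpAlgorithm

variable {n C : ℕ} {A : WakeUpAlgorithm.{u, v} n C}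

/-- At least `n ^ 2 / 3 ^ t` ordered pairs behave alike in all rounds. Without the `n` diagonal
pairs they are quiet, so averaging gives `n ^ 2 / 3 ^ t - n ≤ (n ^ 2 - n) / n`. -/
theorem SolvesWakeUpWHP.le_two_mul_three_pow {t : ℕ} (hA : A.SolvesWakeUpWHP t) (hn : 1 ≤ n) :
    (n : ℝ) ≤ 2 * 3 ^ t := by
  have hn' : (1 : ℝ) ≤ n := by exact_mod_cast hn
  have key := hA.le_sum_div (fun p : Fin n × Fin n => {p.1, p.2})
    (fun p => 1 - if p.1 = p.2 then 1 else 0) (fun p => by split_ifs <;> norm_num)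
    (fun p _ => Finset.insert_nonempty _ _) (δ := (n : ℝ) ^ 2 / 3 ^ t - n) ?_
  · have hdiag : ∑ p : Fin n × Fin n, ((1 : ℝ) - if p.1 = p.2 then 1 else 0) = n ^ 2 - n := by
      rw [Finset.sum_sub_distrib, Fintype.sum_prod_type (f := fun p : Fin n × Fin n =>
        if p.1 = p.2 then (1 : ℝ) else 0)]
      simp [sq]
    rw [hdiag, le_div_iff₀ (by linarith)] at key
    have h3 : (0 : ℝ) < 3 ^ t := by positivity
    have : (n : ℝ) ^ 2 / 3 ^ t * 3 ^ t = n ^ 2 := div_mul_cancel₀ _ h3.ne'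
    set z := (n : ℝ) ^ 2 / 3 ^ t
    have hz : z ≤ 2 * n := by
      by_contra! hlt
      nlinarith
    have : (n : ℝ) * n ≤ n * (2 * 3 ^ t) := by nlinarith
    exact le_of_mul_le_mul_left this (by linarith)
  · intro b
    have hl := sq_card_le_card_mul_sum_ite (fun (i : Fin n) (r : Fin t) =>
      (b r i).map (fun ch => decide ((ch : ℕ) = 0)))
    have hcard : (Fintype.card (Fin t → Option Bool) : ℝ) = 3 ^ t := by simp
    rw [hcard, Fintype.card_fin, ← div_le_iff₀' (by positivity)] at hl
    have hdiag : (n : ℝ) = ∑ p : Fin n × Fin n, if p.1 = p.2 then (1 : ℝ) else 0 := by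
      rw [Fintype.sum_prod_type]; simp
    refine (sub_le_sub_right hl _).trans ?_
    rw [hdiag, ← Finset.sum_sub_distrib]
    refine Finset.sum_le_sum fun p _ => ?_
    by_cases hp : p.1 = p.2
    · simp [hp]
    · simp only [hp, if_false, sub_zero, one_mul]
      split_ifs with h
      · rw [Set.indicator_of_mem, Pi.one_apply]
        exact fun r hr => quietRound_pair hp (congrFun h ⟨r, hr⟩)
      · exact Set.indicator_nonneg (fun _ _ => zero_le_one) p

/-- The adversary mixes all `K` scales, for a total weight of at most `K`. The empty set is not a
legal activation set, and removing it costs the term `exp (-2 ^ K)`. -/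
theorem SolvesWakeUpWHP.exp_le {t : ℕ} (hA : A.SolvesWakeUpWHP t) {K : ℕ} (hK : 0 < K)
    (hn : 4 ^ K ≤ n) :
    Real.exp (-(34 * ((t : ℝ) * C) / K)) - Real.exp (-2 ^ K) ≤ K / n := by
  have hp0 : ∀ k : ℕ, (0 : ℝ) ≤ (1 / 2) ^ (k + 1) := fun k => by positivity
  have hp1 : ∀ k : ℕ, (1 / 2 : ℝ) ^ (k + 1) ≤ 1 :=
    fun k => pow_le_one₀ (by norm_num) (by norm_num)
  have hW : ∀ (k : ℕ) (T : Finset (Fin n)),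
      0 ≤ bernoulliWeight (fun _ : Fin n => (1 / 2 : ℝ) ^ (k + 1)) T :=
    fun k T => bernoulliWeight_nonneg (fun _ => hp0 k) (fun _ => hp1 k) T
  set w : Fin K × Finset (Fin n) → ℝ := fun q =>
    if q.2 = ∅ then 0 else bernoulliWeight (fun _ : Fin n => (1 / 2 : ℝ) ^ ((q.1 : ℕ) + 1)) q.2
    with hw
  have hw0 : ∀ q, 0 ≤ w q := by
    intro q
    simp only [hw]
    split_ifs
    · exact le_rfl
    · exact hW _ _
  have hsum : ∑ q, w q ≤ K := by
    calc ∑ q, w q ≤ ∑ q : Fin K × Finset (Fin n),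
          bernoulliWeight (fun _ : Fin n => (1 / 2 : ℝ) ^ ((q.1 : ℕ) + 1)) q.2 := by
          refine Finset.sum_le_sum fun q _ => ?_
          simp only [hw]
          split_ifs
          · exact hW _ _
          · exact le_rfl
      _ = K := by
          rw [Fintype.sum_prod_type]
          simp [sum_bernoulliWeight]
  refine (hA.le_sum_div (fun q : Fin K × Finset (Fin n) => q.2) w hw0 ?_ ?_).trans
    (div_le_div_of_nonneg_right hsum (Nat.cast_nonneg n))
  · intro q hq
    rw [Finset.nonempty_iff_ne_empty]
    exact fun h => hq (if_pos h)
  · intro b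
    obtain ⟨k, hk, hle⟩ := exists_scale_exp_le
      (fun p : Fin t × Fin C => Finset.univ.filter fun i => b p.1 i = some p.2) hK
    rw [Fintype.card_prod, Fintype.card_fin, Fintype.card_fin, Nat.cast_mul] at hle
    have hempty : bernoulliWeight (fun _ : Fin n => (1 / 2 : ℝ) ^ (k + 1)) ∅ ≤
        Real.exp (-2 ^ K) := by
      rw [bernoulliWeight_empty, Finset.prod_const, Finset.card_univ, Fintype.card_fin]
      refine (pow_le_pow_left₀ (by linarith [hp1 k]) (Real.one_sub_le_exp_neg _) n).trans ?_
      rw [← Real.exp_nat_mul, Real.exp_le_exp, mul_neg, neg_le_neg_iff]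
      have h1 : (1 / 2 : ℝ) ^ K ≤ (1 / 2) ^ (k + 1) :=
        pow_le_pow_of_le_one (by norm_num) (by norm_num) hk
      have h2 : (4 : ℝ) ^ K ≤ n := by exact_mod_cast hn
      calc (2 : ℝ) ^ K = 4 ^ K * (1 / 2) ^ K := by rw [← mul_pow]; norm_num
        _ ≤ n * (1 / 2) ^ (k + 1) := mul_le_mul h2 h1 (by positivity) (Nat.cast_nonneg n)
    set Q : Fin K × Finset (Fin n) → ℝ := {q | ∀ r < t, QuietRound q.2 (b r)}.indicator 1 with hQ
    have hQ0 : ∀ q, 0 ≤ Q q := fun q => Set.indicator_nonneg (fun _ _ => zero_le_one) q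
    -- The good scale depends on the pattern `b`; the other scales are dropped by nonnegativity.
    have hscale : ∑ T : Finset (Fin n), w (⟨k, hk⟩, T) * Q (⟨k, hk⟩, T) ≤ ∑ q, w q * Q q := by
      rw [Fintype.sum_prod_type]
      exact Finset.single_le_sum (f := fun k => ∑ T, w (k, T) * Q (k, T))
        (fun k _ => Finset.sum_nonneg fun T _ => mul_nonneg (hw0 _) (hQ0 _))
        (Finset.mem_univ (⟨k, hk⟩ : Fin K))
    refine le_trans ?_ hscale
    rw [sub_le_iff_le_add]
    refine hle.trans ?_
    rw [bernoulliProb, ← Finset.sum_erase_add _ _ (Finset.mem_univ ∅),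
      ← Finset.sum_erase_add (f := fun T => w (⟨k, hk⟩, T) * Q (⟨k, hk⟩, T)) _ (Finset.mem_univ ∅)]
    have hind : ∀ E : Set (Finset (Fin n)), E.indicator (1 : Finset (Fin n) → ℝ) ∅ ≤ 1 := fun E =>
      Set.indicator_le_self' (fun _ _ => zero_le_one) _
    have h0 : w (⟨k, hk⟩, ∅) = 0 := if_pos rfl
    rw [h0, zero_mul, add_zero]
    refine add_le_add (Finset.sum_le_sum fun T hT => ?_)
      ((mul_le_of_le_one_right (hW k ∅) (hind _)).trans hempty)
    have hwT : w (⟨k, hk⟩, T) = bernoulliWeight (fun _ : Fin n => (1 / 2 : ℝ) ^ (k + 1)) T :=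
      if_neg (Finset.ne_of_mem_erase hT)
    rw [hwT]
    refine mul_le_mul_of_nonneg_left ?_ (hW k T)
    by_cases hmem : T ∈ {T : Finset (Fin n) | ∀ p : Fin t × Fin C,
        (Finset.univ.filter (fun i => b p.1 i = some p.2) ∩ T).card ≠ 1}
    · rw [Set.indicator_of_mem hmem, hQ, Set.indicator_of_mem]
      · exact le_rfl
      · refine fun r hr => quietRound_of_card_ne_one fun ch => ?_
        have := hmem (⟨r, hr⟩, ch)
        rwa [Finset.filter_inter, Finset.univ_inter] at this
    · rw [Set.indicator_of_notMem hmem]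
      exact hQ0 _

end WakeUpAlgorithm

/-! ### Numerical estimates and conclusion -/

theorem sq_le_of_exp_sub_exp_le {K n : ℕ} {m : ℝ} (hK : 2 ≤ K) (hn : 4 ^ K ≤ n)
    (h : Real.exp (-(34 * m / K)) - Real.exp (-2 ^ K) ≤ K / n) : (K : ℝ) ^ 2 ≤ 100 * m := by
  have hK' : (2 : ℝ) ≤ K := by exact_mod_cast hK
  have hn' : (4 : ℝ) ^ K ≤ n := by exact_mod_cast hn
  have h2 : (0 : ℝ) < 2 ^ K := by positivity
  have hK2 : (K : ℝ) ≤ 2 ^ K := by exact_mod_cast Nat.lt_two_pow_self.le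
  have h1 : Real.exp (-2 ^ K) ≤ 1 / 2 ^ K := by
    rw [Real.exp_neg, one_div]
    exact inv_anti₀ h2 (by linarith [Real.add_one_le_exp ((2 : ℝ) ^ K)])
  have h3 : (K : ℝ) / n ≤ 1 / 2 ^ K := by
    calc (K : ℝ) / n ≤ 2 ^ K / 4 ^ K := div_le_div₀ h2.le hK2 (by positivity) hn'
      _ = 1 / 2 ^ K := by
        rw [show (4 : ℝ) = 2 * 2 by norm_num, mul_pow]; field_simp
  have h4 : Real.exp (-(34 * m / K)) ≤ 2 / 2 ^ K := by
    have : (2 : ℝ) / 2 ^ K = 1 / 2 ^ K + 1 / 2 ^ K := by ring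
    linarith
  have h5 := (Real.le_log_iff_exp_le (by positivity)).mpr h4
  rw [Real.log_div (by norm_num) h2.ne', Real.log_pow] at h5
  have h6 : ((K : ℝ) - 1) * Real.log 2 ≤ 34 * m / K := by linarith
  rw [le_div_iff₀ (by linarith)] at h6
  have h7 := Real.log_two_gt_d9
  -- `K ≥ 2` gives `K - 1 ≥ K / 2`; then `0.345 * K ^ 2 ≤ 34 * m`, and `34 / 0.345 < 100`.
  have h8 : (K : ℝ) / 2 * 0.69 ≤ (K - 1) * Real.log 2 :=
    mul_le_mul (by linarith) (by linarith) (by norm_num) (by linarith)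
  have h9 := mul_le_mul_of_nonneg_right h8 (by linarith : (0 : ℝ) ≤ K)
  nlinarith

theorem log_le_of_le_two_mul_three_pow {n t : ℕ} (hn : 2 ≤ n) (ht : 1 ≤ t)
    (h : (n : ℝ) ≤ 2 * 3 ^ t) : Real.log n ≤ 4 * t := by
  have hn' : (2 : ℝ) ≤ n := by exact_mod_cast hn
  have ht' : (1 : ℝ) ≤ t := by exact_mod_cast ht
  have h1 := Real.log_le_log (by linarith) h
  rw [Real.log_mul (by norm_num) (by positivity), Real.log_pow] at h1
  have h2 : Real.log 2 ≤ 2 - 1 := Real.log_le_sub_one_of_pos (by norm_num)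
  have h3 : Real.log 3 ≤ 3 - 1 := Real.log_le_sub_one_of_pos (by norm_num)
  nlinarith

theorem exists_four_pow_le_and_log_le {n : ℕ} (hn : 16 ≤ n) :
    ∃ K : ℕ, 2 ≤ K ∧ 4 ^ K ≤ n ∧ Real.log n ≤ 3 * K := by
  refine ⟨Nat.log 4 n, (Nat.le_log_iff_pow_le (by norm_num) (by omega)).mpr hn,
    Nat.pow_log_le_self 4 (by omega), ?_⟩
  have hK : 2 ≤ Nat.log 4 n := (Nat.le_log_iff_pow_le (by norm_num) (by omega)).mpr hn
  have hK' : (2 : ℝ) ≤ Nat.log 4 n := by exact_mod_cast hK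
  have hlt : (n : ℝ) ≤ 4 ^ (Nat.log 4 n + 1) := by
    exact_mod_cast (Nat.lt_pow_succ_log_self (by norm_num) n).le
  have hn' : (16 : ℝ) ≤ n := by exact_mod_cast hn
  have h1 := Real.log_le_log (by linarith) hlt
  rw [Real.log_pow, show (4 : ℝ) = 2 ^ 2 by norm_num, Real.log_pow] at h1
  have h2 := Real.log_two_lt_d9
  push_cast at h1
  nlinarith

theorem log_le_three_of_lt {n : ℕ} (h1 : 1 ≤ n) (hn : n < 16) : Real.log n ≤ 3 := by
  have hn' : (n : ℝ) ≤ 2 ^ 4 := by exact_mod_cast hn.le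
  have h := Real.log_le_log (by exact_mod_cast h1) hn'
  rw [Real.log_pow] at h
  push_cast at h
  linarith [Real.log_two_lt_d9]

theorem WakeUpAlgorithm.SolvesWakeUpWHP.one_le {n C : ℕ} {A : WakeUpAlgorithm.{u, v} n C} {t : ℕ}
    (hA : A.SolvesWakeUpWHP t) (hn : 2 ≤ n) : 1 ≤ t := by
  by_contra! ht
  have h := hA {⟨0, by omega⟩} (Finset.singleton_nonempty _)
  have hempty : {ω | A.SolvedWithin {⟨0, by omega⟩} ω t} = ∅ := by
    refine Set.eq_empty_of_forall_notMem fun ω => ?_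
    rintro ⟨r, hr, -⟩
    omega
  rw [hempty, MeasureTheory.measureReal_empty, sub_nonpos, le_div_iff₀ (by positivity)] at h
  have : (2 : ℝ) ≤ n := by exact_mod_cast hn
  linarith

theorem mainTheorem8 :
    ∃ c : ℝ, 0 < c ∧
      ∀ (n C : ℕ), 1 ≤ n → 1 ≤ C →
        ∀ (A : WakeUpAlgorithm.{u, v} n C) (t : ℕ), A.SolvesWakeUpWHP t →
          c * (Real.log n ^ 2 / C + Real.log n) ≤ t := by
  refine ⟨1 / 1000, by norm_num, fun n C hn hC A t hA => ?_⟩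
  have hC' : (1 : ℝ) ≤ C := by exact_mod_cast hC
  have hlog : 0 ≤ Real.log n := Real.log_natCast_nonneg n
  rcases hn.eq_or_lt with rfl | hn2
  · simp
  have ht := hA.one_le hn2
  have ht' : (1 : ℝ) ≤ t := by exact_mod_cast ht
  suffices h : Real.log n ^ 2 / C + Real.log n ≤ 1000 * t by linarith
  -- For small `n` the bound `1 ≤ t` is enough; from `16 = 4 ^ 2` on, there is a `K ≥ 2` with `4 ^ K
  -- ≤ n`.
  rcases lt_or_ge n 16 with hlt | hge
  · have h1 := log_le_three_of_lt hn hlt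
    have h2 : Real.log n ^ 2 / C ≤ Real.log n ^ 2 := div_le_self (sq_nonneg _) hC'
    nlinarith
  · have h1 := log_le_of_le_two_mul_three_pow hn2 ht (hA.le_two_mul_three_pow hn)
    obtain ⟨K, hK, hKn, hlogK⟩ := exists_four_pow_le_and_log_le hge
    have h2 := sq_le_of_exp_sub_exp_le hK hKn (hA.exp_le (by omega) hKn)
    have h3 : Real.log n ^ 2 / C ≤ 900 * t := by
      rw [div_le_iff₀ (by linarith)]
      calc Real.log n ^ 2 ≤ (3 * K) ^ 2 := pow_le_pow_left₀ hlog hlogK 2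
        _ ≤ 900 * t * C := by linarith
    linarith
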